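/- Let $(\mathcal X,\mathcal B)$ be a measurable space, $\pi$ a probability measure on it, and $\{P_\gamma\}_{\gamma\in\Gamma}$ a family of Markov kernels on $\mathcal X$ that are all $\pi$-invariant, $\pi$-irreducible and aperiodic. Suppose there are a measurable set $C$ with $\pi(C)>0$, a probability measure $\nu$ and a constant $\delta_0>0$ with $$P_\gamma(x,\cdot)\ \ge\ \delta_0\,\nu(\cdot)\qquad\text{for all }x\in C,\ \gamma\in\Gamma,$$ and that the simultaneous geometric drift condition holds: there are a measurable $V:\mathcal X\to[1,\infty)$ and constants $0<\lambda<1$, $b<\infty$ with $$P_\gamma V\ \le\ \lambda V+b\,\mathbf 1_C\qquad\text{for all }\gamma\in\Gamma .$$ For $\gamma\in\Gamma$ let $(X_n,Y_n)_{n\ge0}$ be the split chain on $\mathcal X\times\{0,1\}$ with $X_0\sim\nu$: given $X_n$ and the past, $Y_n=1$ with probability $\delta_0\mathbf 1_C(X_n)$; given $(X_n,Y_n)$ and the past, $X_{n+1}$ has law $\nu$ if $Y_n=1$, and law $$Q_\gamma(X_n,\cdot)=\frac{P_\gamma(X_n,\cdot)-\delta_0\nu(\cdot)\mathbf 1_C(X_n)}{1-\delta_0\mathbf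 1_C(X_n)}$$ if $Y_n=0$. Write $\mathbb E_{\nu,\gamma}$ for expectation under its law, and let $T=\inf\{n\ge1:Y_{n-1}=1\}$ be the regeneration time. Assume $\sup_{x\in C}V(x)<\infty$, and let $f:\mathcal X\to\mathbb R$ be measurable with $$\|f\|_{V^{1/2-\varepsilon}}:=\sup_{x\in\mathcal X}\frac{|f(x)|}{V(x)^{1/2-\varepsilon}}<\infty\qquad\text{for some }\varepsilon>0 .$$ Then for every $\gamma\in\Gamma$ the time $T$ is almost surely finite, and there is $\eta>0$ such that $$\sup_{\gamma\in\Gamma}\ \mathbb E_{\nu,\gamma}\left|\sum_{j=0}^{T-1}f(X_j)\right|^{2+\eta}<\infty .$$ -/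

import Mathlib

open MeasureTheory ProbabilityTheory
open scoped ENNReal NNReal

namespace AirMCMC

variable {Γ X : Type*} [MeasurableSpace X]

/-- A Markov kernel `K` is aperiodic (relative to its invariant probability measure `π`) if it has
no `d`-cycle with `d ≥ 2`: there are no pairwise disjoint measurable sets `D 0, …, D (d - 1)`
whose union has full measure and such that from `D i` the chain moves to `D (i + 1)`
(indices modulo `d`) with probability one. -/
def IsAperiodic (K : Kernel X X) (π : Measure X) : Prop :=
  ¬ ∃ (d : ℕ) (D : ZMod d → Set X), 2 ≤ d ∧ (∀ i, MeasurableSet (D i)) ∧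
    (∀ i j, i ≠ j → Disjoint (D i) (D j)) ∧
    (∀ i, ∀ x ∈ D i, K x (D (i + 1)) = 1) ∧ π (⋃ i, D i)ᶜ = 0

/-- The standing assumptions on the family of kernels: invariance, irreducibility, aperiodicity,
and the one step simultaneous minorisation `P γ x ≥ δ ν` for `x ∈ C` and all `γ`. -/
structure RegularSmallSet (P : Γ → Kernel X X) (π : Measure X) (C : Set X) (δ : ℝ≥0)
    (ν : Measure X) : Prop where
  invariant : ∀ γ, Kernel.Invariant (P γ) π
  irreducible : ∀ γ, Kernel.IsIrreducible π (P γ)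
  aperiodic : ∀ γ, IsAperiodic (P γ) π
  measurableSet : MeasurableSet C
  mass_pos : 0 < π C
  delta_pos : 0 < δ
  minorisation : ∀ γ, ∀ x ∈ C, δ • ν ≤ P γ x

/-- Simultaneous geometric drift `P γ V ≤ lam V + b 1_C` with `0 < lam < 1`, `V ≥ 1`. -/
structure GeometricDrift (P : Γ → Kernel X X) (C : Set X) (V : X → ℝ) (lam b : ℝ) : Prop where
  measurable : Measurable V
  one_le : ∀ x, 1 ≤ V x
  lam_pos : 0 < lam
  lam_lt_one : lam < 1
  drift : ∀ γ x, ∫⁻ y, ENNReal.ofReal (V y) ∂(P γ x) ≤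
    ENNReal.ofReal (lam * V x + C.indicator (fun _ => b) x)

/-- The weighted supremum norm `sup_x |g x| / W x` (for `W > 0`), with values in `[0, ∞]`. -/
noncomputable def wNorm (W g : X → ℝ) : ℝ≥0∞ := ⨆ x, ENNReal.ofReal (|g x| / W x)

section SplitChain

variable {C : Set X} {δ : ℝ≥0} {ν : Measure X}

theorem delta_le_one {K : Kernel X X} [IsMarkovKernel K] [IsProbabilityMeasure ν]
    (hmin : ∀ x ∈ C, δ • ν ≤ K x) {x : X} (hx : x ∈ C) : δ ≤ 1 := by
  have h := hmin x hx Set.univ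
  rw [Measure.smul_apply, measure_univ, measure_univ, ENNReal.smul_def, smul_eq_mul, mul_one] at h
  exact_mod_cast h

open Classical in
/-- The law of the coin `Y` given the state `x`: it is `true` with probability `δ 1_C(x)`. -/
noncomputable def coinMeasure (C : Set X) (δ : ℝ≥0) (x : X) : Measure Bool :=
  if x ∈ C then δ • Measure.dirac true + (1 - δ) • Measure.dirac false else Measure.dirac false

/-- The coin as a kernel. -/
noncomputable def coinKernel (hC : MeasurableSet C) (δ : ℝ≥0) : Kernel X Bool where
  toFun := coinMeasure C δ
  measurable' := by
    classical
    unfold coinMeasure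
    exact Measurable.ite hC measurable_const measurable_const

theorem isMarkovKernel_coinKernel (hC : MeasurableSet C) {K : Kernel X X} [IsMarkovKernel K]
    [IsProbabilityMeasure ν] (hmin : ∀ x ∈ C, δ • ν ≤ K x) :
    IsMarkovKernel (coinKernel hC δ) := by
  refine ⟨fun x => ⟨?_⟩⟩
  change coinMeasure C δ x Set.univ = 1
  unfold coinMeasure
  split_ifs with hx
  · have h := delta_le_one hmin hx
    simp only [Measure.add_apply, Measure.smul_apply, measure_univ, ENNReal.smul_def, smul_eq_mul,
      mul_one]
    exact_mod_cast add_tsub_cancel_of_le h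
  · simp

open Classical in
/-- The residual law `Q(x, ·) = (K(x, ·) - δ ν 1_C(x)) / (1 - δ 1_C(x))`. When `δ = 1` and `x ∈ C`
this is `0 / 0`; it is then never used by the split chain, and is set to `ν`. -/
noncomputable def residualMeasure (K : Kernel X X) (C : Set X) (δ : ℝ≥0) (ν : Measure X) (x : X) :
    Measure X :=
  if x ∈ C then (if δ < 1 then (1 - δ)⁻¹ • (K x - δ • ν) else ν) else K x

/-- The residual law as a kernel. -/
noncomputable def residualKernel (K : Kernel X X) [IsProbabilityMeasure ν]
    (hC : MeasurableSet C) (hmin : ∀ x ∈ C, δ • ν ≤ K x) : Kernel X X where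
  toFun := residualMeasure K C δ ν
  measurable' := by
    classical
    refine Measure.measurable_of_measurable_coe _ fun s hs => ?_
    have key : (fun x => residualMeasure K C δ ν x s) = fun x =>
        if x ∈ C then (if δ < 1 then (((1 - δ)⁻¹ : ℝ≥0) : ℝ≥0∞) * (K x s - δ * ν s) else ν s)
        else K x s := by
      funext x
      unfold residualMeasure
      split_ifs with hx hd
      · rw [Measure.smul_apply, Measure.sub_apply hs (hmin x hx), ENNReal.smul_def, smul_eq_mul,
          Measure.smul_apply, ENNReal.smul_def, smul_eq_mul]
      · rfl
      · rfl
    rw [key]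
    have hK : Measurable fun x => K x s := K.measurable_coe hs
    refine Measurable.ite hC ?_ hK
    split_ifs
    · exact (hK.sub_const _).const_mul _
    · exact measurable_const

theorem isMarkovKernel_residualKernel (K : Kernel X X) [IsMarkovKernel K] [IsProbabilityMeasure ν]
    (hC : MeasurableSet C) (hmin : ∀ x ∈ C, δ • ν ≤ K x) :
    IsMarkovKernel (residualKernel K hC hmin) := by
  refine ⟨fun x => ⟨?_⟩⟩
  change residualMeasure K C δ ν x Set.univ = 1
  unfold residualMeasure
  split_ifs with hx hd
  · rw [Measure.smul_apply, Measure.sub_apply MeasurableSet.univ (hmin x hx), Measure.smul_apply,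
      measure_univ, measure_univ, ENNReal.smul_def, smul_eq_mul, ENNReal.smul_def, smul_eq_mul,
      mul_one]
    have h0 : (1 - δ) ≠ 0 := (tsub_pos_of_lt hd).ne'
    have : ((1 - δ)⁻¹ * (1 - δ) : ℝ≥0) = 1 := inv_mul_cancel₀ h0
    exact_mod_cast this
  · exact measure_univ
  · exact measure_univ

/-- The law of `X_n` given `(X_{n-1}, Y_{n-1})`: it is `ν` if `Y_{n-1} = 1` and
`Q(X_{n-1}, ·)` if `Y_{n-1} = 0`. -/
noncomputable def moveKernel (K : Kernel X X) [IsProbabilityMeasure ν]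
    (hC : MeasurableSet C) (hmin : ∀ x ∈ C, δ • ν ≤ K x) : Kernel (X × Bool) X where
  toFun z := if z.2 = true then ν else residualKernel K hC hmin z.1
  measurable' :=
    Measurable.ite (measurable_snd (measurableSet_singleton true)) measurable_const
      ((residualKernel K hC hmin).measurable.comp measurable_fst)

theorem isMarkovKernel_moveKernel (K : Kernel X X) [IsMarkovKernel K] [IsProbabilityMeasure ν]
    (hC : MeasurableSet C) (hmin : ∀ x ∈ C, δ • ν ≤ K x) :
    IsMarkovKernel (moveKernel K hC hmin) := by
  have := isMarkovKernel_residualKernel K hC hmin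
  refine ⟨fun z => ?_⟩
  change IsProbabilityMeasure (if z.2 = true then ν else residualKernel K hC hmin z.1)
  split_ifs <;> infer_instance

/-- From a state `x`, the pair `(x, Y)` with `Y` the coin at `x`. -/
noncomputable def attachCoin (hC : MeasurableSet C) (δ : ℝ≥0) : Kernel X (X × Bool) :=
  Kernel.id ×ₖ coinKernel hC δ

/-- Transition kernel of the split chain: `X_n` is drawn given `(X_{n-1}, Y_{n-1})`, then `Y_n` is
the coin at `X_n`. -/
noncomputable def splitKernel (K : Kernel X X) [IsProbabilityMeasure ν]
    (hC : MeasurableSet C) (hmin : ∀ x ∈ C, δ • ν ≤ K x) : Kernel (X × Bool) (X × Bool) :=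
  attachCoin hC δ ∘ₖ moveKernel K hC hmin

theorem isMarkovKernel_splitKernel (K : Kernel X X) [IsMarkovKernel K] [IsProbabilityMeasure ν]
    (hC : MeasurableSet C) (hmin : ∀ x ∈ C, δ • ν ≤ K x) :
    IsMarkovKernel (splitKernel K hC hmin) := by
  have := isMarkovKernel_coinKernel hC hmin
  have := isMarkovKernel_moveKernel K hC hmin
  unfold splitKernel attachCoin
  infer_instance

/-- The law, on trajectories `ω = (X_n, Y_n)_{n ≥ 0}`, of the split chain of `K` started from
`X_0 ∼ ν`. -/
noncomputable def splitLaw (K : Kernel X X) [IsMarkovKernel K] [IsProbabilityMeasure ν]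
    (hC : MeasurableSet C) (hmin : ∀ x ∈ C, δ • ν ≤ K x) : Measure (ℕ → X × Bool) :=
  haveI := isMarkovKernel_coinKernel hC hmin
  haveI := isMarkovKernel_splitKernel K hC hmin
  haveI : IsProbabilityMeasure (ν.bind (attachCoin hC δ)) := by
    unfold attachCoin
    infer_instance
  Kernel.trajMeasure (X := fun _ => X × Bool) (ν.bind (attachCoin hC δ))
    (fun n => (splitKernel K hC hmin).comap
      (fun h : (Finset.Iic n → X × Bool) => h ⟨n, Finset.mem_Iic.2 le_rfl⟩)
      (measurable_pi_apply _))

end SplitChain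

/-- The regeneration time `T = inf {n ≥ 1 : Y_{n-1} = 1}`, with `inf ∅ = ∞`. -/
noncomputable def regenTime (ω : ℕ → X × Bool) : ℕ∞ :=
  ⨅ (n : ℕ) (_ : 1 ≤ n ∧ (ω (n - 1)).2 = true), (n : ℕ∞)

/-- The tour sum `∑_{j = 0}^{T - 1} f(X_j)` (meaningful when `T < ∞`). -/
noncomputable def tourSum (f : X → ℝ) (ω : ℕ → X × Bool) : ℝ :=
  ∑ j ∈ Finset.range (regenTime ω).toNat, f (ω j).1

/-- The uniform moment condition on tour sums: under every `γ` the regeneration time is almost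
surely finite (so that the tour sum is defined), and for some `η > 0`,
`sup_γ E_{ν,γ} |∑_{j<T} f(X_j)|^{2+η} < ∞`. -/
def TourMomentCondition (P : Γ → Kernel X X) [∀ γ, IsMarkovKernel (P γ)] {π : Measure X}
    {C : Set X} {δ : ℝ≥0} {ν : Measure X} [IsProbabilityMeasure ν]
    (h : RegularSmallSet P π C δ ν) (f : X → ℝ) : Prop :=
  (∀ γ, ∀ᵐ ω ∂(splitLaw (P γ) h.measurableSet (h.minorisation γ)), regenTime ω ≠ ⊤) ∧
  ∃ η : ℝ, 0 < η ∧
    ⨆ γ, ∫⁻ ω, ENNReal.ofReal (|tourSum f ω| ^ (2 + η))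
      ∂(splitLaw (P γ) h.measurableSet (h.minorisation γ)) < ∞

end AirMCMC

/-! Killing the chain at regeneration turns the drift inequality into a strict contraction. Choose
`β ≥ 0` with `b ≤ δ * β` and put `W = V + β`. On `C`, removing `δ ν` from `P γ x` removes mass `δ`,
so the constant `β` loses `δ β`, which pays for `b`. Both on and off `C` the remaining kernel sends
`W` below `k W`, with `k = (lam + β) / (1 + β) < 1` independent of `γ`. Iterating along the split
chain, `lintegral_survival_mul_le` gives `E[W(X_n); T > n] ≤ k ^ n ν(W)`.

With `p = 2 + 4ε`, the norm bound on `f` gives `|f| ^ p ≤ c W`. Hölder's inequality with geometric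
weights (`sum_rpow_le_geometric`) bounds the `p`-th power of the tour sum by a multiple of `∑ ρ ^ n
W(X_n) 1_{T > n}` with `ρ > 1`. Taking `ρ = k ^ (-1/2)` leaves a geometric series of ratio `k ^
(1/2)`, hence a bound uniform in `γ`. Finiteness of the same series forces `T < ∞` almost surely. -/

namespace AirMCMC

/-! ### Integrals along a homogeneous Markov trajectory. -/

section MarkovTrajectory

variable {E : Type*} [MeasurableSpace E]

/-- The kernels on histories that move the last state by `κ`. -/
noncomputable def lastStateKernel (κ : Kernel E E) (n : ℕ) :
    Kernel (Finset.Iic n → E) E :=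
  κ.comap (fun h => h ⟨n, Finset.mem_Iic.2 le_rfl⟩) (measurable_pi_apply _)

instance (κ : Kernel E E) [IsMarkovKernel κ] (n : ℕ) : IsMarkovKernel (lastStateKernel κ n) := by
  unfold lastStateKernel
  infer_instance

theorem lintegral_trajMeasure_zero (μ₀ : Measure E) [IsProbabilityMeasure μ₀] (κ : Kernel E E)
    [IsMarkovKernel κ] {g : E → ℝ≥0∞} (hg : Measurable g) :
    ∫⁻ ω, g (ω 0) ∂(Kernel.trajMeasure (X := fun _ => E) μ₀ (lastStateKernel κ)) =
      ∫⁻ z, g z ∂μ₀ := by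
  have h0 : (Kernel.trajMeasure (X := fun _ => E) μ₀ (lastStateKernel κ)).map
      (Preorder.frestrictLe 0) = μ₀.map (MeasurableEquiv.piUnique _).symm := by
    rw [Kernel.trajMeasure, Measure.map_comp _ _ (by fun_prop), Kernel.traj_map_frestrictLe,
      Kernel.partialTraj_self, Measure.id_comp]
  have hG : Measurable fun h : Finset.Iic 0 → E => g (h ⟨0, Finset.mem_Iic.2 le_rfl⟩) := by
    fun_prop
  have h := lintegral_map (μ := Kernel.trajMeasure (X := fun _ => E) μ₀ (lastStateKernel κ)) hG
    (g := Preorder.frestrictLe 0) (by fun_prop)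
  rw [h0, lintegral_map hG (by fun_prop)] at h
  exact h.symm

/-- The Markov property in integrated form: the last coordinate is averaged out given the history up
to time `n`. -/
theorem lintegral_trajMeasure_succ (μ₀ : Measure E) [IsProbabilityMeasure μ₀] (κ : Kernel E E)
    [IsMarkovKernel κ] (n : ℕ) {F : (Finset.Iic n → E) → ℝ≥0∞} (hF : Measurable F)
    {g : E → ℝ≥0∞} (hg : Measurable g) :
    ∫⁻ ω, F (Preorder.frestrictLe n ω) * g (ω (n + 1))
      ∂(Kernel.trajMeasure (X := fun _ => E) μ₀ (lastStateKernel κ)) =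
    ∫⁻ ω, F (Preorder.frestrictLe n ω) * ∫⁻ z, g z ∂(κ (ω n))
      ∂(Kernel.trajMeasure (X := fun _ => E) μ₀ (lastStateKernel κ)) := by
  have key := Kernel.map_frestrictLe_trajMeasure_compProd_eq_map_trajMeasure
    (X := fun _ => E) (κ := lastStateKernel κ) (μ₀ := μ₀) (a := n)
  have hFg : Measurable fun q : (Finset.Iic n → E) × E => F q.1 * g q.2 := by fun_prop
  have h := congrArg (fun m => ∫⁻ q, F q.1 * g q.2 ∂m) key
  beta_reduce at h
  rw [Measure.lintegral_compProd hFg,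
    lintegral_map hFg.lintegral_kernel_prod_right' (by fun_prop),
    lintegral_map hFg (by fun_prop)] at h
  rw [← h]
  refine lintegral_congr fun ω => ?_
  exact lintegral_const_mul (μ := κ (ω n)) (F (Preorder.frestrictLe n ω)) hg

end MarkovTrajectory

variable {X : Type*} [MeasurableSpace X]

/-! ### Survival up to the regeneration time. -/

/-- The indicator that no regeneration coin has come up before time `n`. -/
noncomputable def survival (n : ℕ) : (ℕ → X × Bool) → ℝ≥0∞ :=
  Set.indicator {ω | ∀ i < n, (ω i).2 = false} 1

theorem measurable_survival (n : ℕ) : Measurable (survival (X := X) n) := by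
  refine measurable_one.indicator ?_
  have : {ω : ℕ → X × Bool | ∀ i < n, (ω i).2 = false} =
      ⋂ i, ⋂ (_ : i < n), (fun ω : ℕ → X × Bool => (ω i).2) ⁻¹' {false} := by
    ext; simp
  rw [this]
  exact MeasurableSet.iInter fun i => MeasurableSet.iInter fun _ =>
    (measurable_snd.comp (measurable_pi_apply i)) (measurableSet_singleton _)

omit [MeasurableSpace X] in
theorem survival_succ (n : ℕ) (ω : ℕ → X × Bool) :
    survival (n + 1) ω = survival n ω * if (ω n).2 = true then 0 else 1 := by
  classical
  simp only [survival, Set.indicator_apply, Set.mem_ofPred_eq, Order.lt_add_one_iff, Pi.one_apply,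
    Nat.le_iff_lt_or_eq, or_imp, forall_and, forall_eq]
  cases (ω n).2 <;> simp

/-- Survival to time `n + 1` involves only the coins `0, …, n`, so the Markov property at time `n`
applies to it. -/
theorem exists_survival_succ_eq (n : ℕ) : ∃ F : (Finset.Iic n → X × Bool) → ℝ≥0∞, Measurable F ∧
    ∀ ω, survival (n + 1) ω = F (Preorder.frestrictLe n ω) := by
  classical
  refine ⟨Set.indicator {h | ∀ i, (h i).2 = false} 1, measurable_one.indicator ?_, fun ω => ?_⟩
  · have : {h : Finset.Iic n → X × Bool | ∀ i, (h i).2 = false} =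
        ⋂ i, (fun h : Finset.Iic n → X × Bool => (h i).2) ⁻¹' {false} := by
      ext; simp
    rw [this]
    exact MeasurableSet.iInter fun i =>
      (measurable_snd.comp (measurable_pi_apply i)) (measurableSet_singleton _)
  · simp only [survival, Set.indicator_apply, Set.mem_ofPred_eq, Nat.lt_succ_iff, Subtype.forall,
      Finset.mem_Iic, Preorder.frestrictLe_apply, Pi.one_apply]
    congr

omit [MeasurableSpace X] in
theorem survival_eq_one_of_lt_regenTime {ω : ℕ → X × Bool} {n : ℕ}
    (h : (n : ℕ∞) < regenTime ω) : survival n ω = 1 := by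
  refine Set.indicator_of_mem (s := {ω : ℕ → X × Bool | ∀ i < n, (ω i).2 = false})
    (fun i hi => ?_) _
  by_contra hne
  have hle : regenTime ω ≤ ((i + 1 : ℕ) : ℕ∞) :=
    iInf₂_le (i + 1) ⟨by omega, by simpa using hne⟩
  exact absurd (Nat.cast_lt.1 (h.trans_le hle)) (by omega)

/-! ### One killed step of the split chain. -/

section OneStep

variable {C : Set X} {δ : ℝ≥0} {ν : Measure X}

theorem lintegral_attachCoin (hC : MeasurableSet C) {g : X × Bool → ℝ≥0∞} (hg : Measurable g)
    {K : Kernel X X} [IsMarkovKernel K] [IsProbabilityMeasure ν]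
    (hmin : ∀ x ∈ C, δ • ν ≤ K x) (x : X) :
    ∫⁻ z, g z ∂(attachCoin hC δ x) = ∫⁻ y, g (x, y) ∂(coinMeasure C δ x) := by
  have := isMarkovKernel_coinKernel hC hmin
  unfold attachCoin
  rw [Kernel.lintegral_id_prod hg]
  rfl

/-- If the part of `K` that does not regenerate contracts `W` by the factor `a`, then so does one
step of the split chain (coin, then move) killed at regeneration. -/
theorem lintegral_attachCoin_killed_le (K : Kernel X X) [IsMarkovKernel K] [IsProbabilityMeasure ν]
    (hC : MeasurableSet C) (hmin : ∀ x ∈ C, δ • ν ≤ K x) {W : X → ℝ≥0∞} (hW : Measurable W)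
    {a : ℝ≥0∞} (hout : ∀ x ∉ C, ∫⁻ y, W y ∂(K x) ≤ a * W x)
    (hin : ∀ x ∈ C, ∫⁻ y, W y ∂(K x - δ • ν) ≤ a * W x) (x : X) :
    ∫⁻ z, (if z.2 = true then 0 else 1) * ∫⁻ y, W y ∂(moveKernel K hC hmin z)
      ∂(attachCoin hC δ x) ≤ a * W x := by
  have hm : Measurable fun z : X × Bool => (if z.2 = true then 0 else 1 : ℝ≥0∞) *
      ∫⁻ y, W y ∂(moveKernel K hC hmin z) :=
    (Measurable.ite (measurable_snd (measurableSet_singleton true)) measurable_const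
      measurable_const).mul hW.lintegral_kernel
  rw [lintegral_attachCoin hC hm hmin]
  have hmove : moveKernel K hC hmin (x, false) = residualMeasure K C δ ν x := rfl
  unfold coinMeasure
  split_ifs with hx
  · rw [lintegral_add_measure, lintegral_smul_measure, lintegral_smul_measure, lintegral_dirac,
      lintegral_dirac]
    simp only [if_true, zero_mul, smul_zero, zero_add, Bool.false_eq_true, if_false, one_mul, hmove,
      residualMeasure, hx]
    split_ifs with hd
    · have h0 : (1 - δ) ≠ 0 := (tsub_pos_of_lt hd).ne'
      rw [lintegral_smul_measure, smul_smul, mul_inv_cancel₀ h0, one_smul]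
      exact hin x hx
    -- When `δ = 1` the coin never shows `false` on `C`, so the default value of the residual law
    -- has weight zero.
    · rw [tsub_eq_zero_of_le (not_lt.1 hd), zero_smul]
      exact zero_le
  · rw [lintegral_dirac]
    simpa [hmove, residualMeasure, hx] using hout x hx

end OneStep

/-! ### Geometric decay of `W` along surviving trajectories. -/

section Moments

variable {C : Set X} {δ : ℝ≥0} {ν : Measure X}

theorem lintegral_survival_mul_le (K : Kernel X X) [IsMarkovKernel K] [IsProbabilityMeasure ν]
    (hC : MeasurableSet C) (hmin : ∀ x ∈ C, δ • ν ≤ K x) {W : X → ℝ≥0∞} (hW : Measurable W)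
    {a : ℝ≥0∞} (hout : ∀ x ∉ C, ∫⁻ y, W y ∂(K x) ≤ a * W x)
    (hin : ∀ x ∈ C, ∫⁻ y, W y ∂(K x - δ • ν) ≤ a * W x) (n : ℕ) :
    ∫⁻ ω, survival n ω * W (ω n).1 ∂(splitLaw K hC hmin) ≤ a ^ n * ∫⁻ x, W x ∂ν := by
  have := isMarkovKernel_coinKernel hC hmin
  have := isMarkovKernel_moveKernel K hC hmin
  have := isMarkovKernel_splitKernel K hC hmin
  have : IsMarkovKernel (attachCoin hC δ) := by unfold attachCoin; infer_instance
  have hlaw : splitLaw K hC hmin = Kernel.trajMeasure (X := fun _ => X × Bool)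
    (ν.bind (attachCoin hC δ)) (lastStateKernel (splitKernel K hC hmin)) := rfl
  rw [hlaw]
  set μ := Kernel.trajMeasure (X := fun _ => X × Bool)
    (ν.bind (attachCoin hC δ)) (lastStateKernel (splitKernel K hC hmin))
  set M : X × Bool → ℝ≥0∞ := fun z => ∫⁻ y, W y ∂(moveKernel K hC hmin z)
  set alive : X × Bool → ℝ≥0∞ := fun z => if z.2 = true then 0 else 1
  have halive : Measurable alive := Measurable.ite
    (measurable_snd (measurableSet_singleton true)) measurable_const measurable_const
  have hM : Measurable M := hW.lintegral_kernel
  set G : X × Bool → ℝ≥0∞ := fun z => alive z * M z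
  have hG : Measurable G := halive.mul hM
  have hkill : ∀ x, ∫⁻ z, G z ∂(attachCoin hC δ x) ≤ a * W x :=
    lintegral_attachCoin_killed_le K hC hmin hW hout hin
  have hfst : ∀ x, ∫⁻ z, W z.1 ∂(attachCoin hC δ x) = W x := fun x => by
    rw [lintegral_attachCoin hC (by fun_prop) hmin]
    have : IsProbabilityMeasure (coinMeasure C δ x) :=
      inferInstanceAs (IsProbabilityMeasure (coinKernel hC δ x))
    exact (lintegral_const (W x)).trans (by rw [measure_univ, mul_one])
  have hstep : ∀ (n : ℕ) {g : X × Bool → ℝ≥0∞}, Measurable g →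
      ∫⁻ ω, survival (n + 1) ω * g (ω (n + 1)) ∂μ =
        ∫⁻ ω, survival (n + 1) ω * ∫⁻ x, ∫⁻ z, g z ∂(attachCoin hC δ x)
          ∂(moveKernel K hC hmin (ω n)) ∂μ := by
    intro n g hg
    obtain ⟨F, hF, hsF⟩ := exists_survival_succ_eq (X := X) n
    simp_rw [hsF]
    rw [lintegral_trajMeasure_succ _ _ _ hF hg]
    refine lintegral_congr fun ω => ?_
    rw [splitKernel, Kernel.lintegral_comp _ _ _ hg]
  -- The induction runs at half steps, after the coin at time `n` and before the move, because the
  -- contraction concerns a coin followed by a move.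
  have hmove : ∀ n, ∫⁻ ω, survival (n + 1) ω * M (ω n) ∂μ ≤ a ^ (n + 1) * ∫⁻ x, W x ∂ν := by
    intro n
    induction n with
    | zero =>
      have h1 : ∀ ω : ℕ → X × Bool, survival 1 ω * M (ω 0) = G (ω 0) :=
        fun ω => by rw [survival_succ]; simp [survival, G, alive]
      rw [zero_add, lintegral_congr h1, lintegral_trajMeasure_zero _ _ hG,
        Measure.lintegral_bind (Kernel.aemeasurable _) hG.aemeasurable, pow_one,
        ← lintegral_const_mul _ hW]
      exact lintegral_mono hkill
    | succ n ih =>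
      have h1 : ∀ ω : ℕ → X × Bool, survival (n + 1 + 1) ω * M (ω (n + 1)) =
          survival (n + 1) ω * G (ω (n + 1)) :=
        fun ω => by rw [survival_succ, mul_assoc]
      rw [lintegral_congr h1, hstep n hG]
      calc _ ≤ ∫⁻ ω, a * (survival (n + 1) ω * M (ω n)) ∂μ := by
            refine lintegral_mono fun ω => ?_
            rw [mul_left_comm]
            refine mul_le_mul_right ?_ _
            rw [← lintegral_const_mul _ hW]
            exact lintegral_mono hkill
        _ ≤ _ := by
            have hm : Measurable fun ω : ℕ → X × Bool => survival (n + 1) ω * M (ω n) :=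
              (measurable_survival _).mul (hM.comp (measurable_pi_apply n))
            rw [lintegral_const_mul _ hm, pow_succ' a (n + 1), mul_assoc]
            exact mul_le_mul_right ih _
  cases n with
  | zero =>
    have h1 : ∀ ω : ℕ → X × Bool, survival 0 ω * W (ω 0).1 = W (ω 0).1 :=
      fun ω => by simp [survival]
    rw [lintegral_congr h1, lintegral_trajMeasure_zero _ _ (g := fun z : X × Bool => W z.1)
        (by fun_prop),
      Measure.lintegral_bind (Kernel.aemeasurable _) (by fun_prop)]
    simp [hfst]
  | succ n =>
    have h := hstep n (g := fun z => W z.1) (by fun_prop)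
    simp_rw [hfst] at h
    rw [h]
    exact hmove n

/-- No smallness of `r * a` is required: the geometric series formula holds in `[0, ∞]`. -/
theorem lintegral_tsum_survival_le (K : Kernel X X) [IsMarkovKernel K] [IsProbabilityMeasure ν]
    (hC : MeasurableSet C) (hmin : ∀ x ∈ C, δ • ν ≤ K x) {W : X → ℝ≥0∞} (hW : Measurable W)
    {a : ℝ≥0∞} (hout : ∀ x ∉ C, ∫⁻ y, W y ∂(K x) ≤ a * W x)
    (hin : ∀ x ∈ C, ∫⁻ y, W y ∂(K x - δ • ν) ≤ a * W x) (r : ℝ≥0∞) :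
    ∫⁻ ω, ∑' n, r ^ n * (survival n ω * W (ω n).1) ∂(splitLaw K hC hmin) ≤
      (1 - r * a)⁻¹ * ∫⁻ x, W x ∂ν := by
  have hm : ∀ n, Measurable fun ω : ℕ → X × Bool => survival n ω * W (ω n).1 := fun n =>
    (measurable_survival n).mul (by fun_prop)
  rw [lintegral_tsum fun n => ((hm n).const_mul _).aemeasurable, ← ENNReal.tsum_geometric,
    ← ENNReal.tsum_mul_right]
  refine ENNReal.tsum_le_tsum fun n => ?_
  rw [lintegral_const_mul _ (hm n), mul_pow, mul_assoc]
  exact mul_le_mul_right (lintegral_survival_mul_le K hC hmin hW hout hin n) _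

end Moments

/-! ### From weighted series to tour sums and finiteness of `T`. -/

/-- A power of a finite sum is controlled by a geometrically weighted sum of powers. -/
theorem sum_rpow_le_geometric {p r : ℝ} (hp : 1 ≤ p) (hr0 : 0 < r) (hr1 : r < 1) {u : ℕ → ℝ}
    (hu : ∀ j, 0 ≤ u j) (n : ℕ) :
    (∑ j ∈ Finset.range n, u j) ^ p ≤
      ((1 - r)⁻¹) ^ (p - 1) * ∑ j ∈ Finset.range n, (r ^ (1 - p)) ^ j * u j ^ p := by
  have hp0 : 0 < p := by linarith
  have hrj : ∀ j : ℕ, 0 < r ^ j := fun j => pow_pos hr0 j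
  -- Hölder with weights `r ^ j` applied to `u j / r ^ j`; the total weight is at most `(1 - r)⁻¹`.
  have h := Real.inner_le_weight_mul_Lp_of_nonneg (Finset.range n) hp (fun j => r ^ j)
    (fun j => (r ^ j)⁻¹ * u j) (fun j => (hrj j).le)
    (fun j => mul_nonneg (inv_nonneg.2 (hrj j).le) (hu j))
  have e1 : ∀ j, r ^ j * ((r ^ j)⁻¹ * u j) = u j := fun j =>
    mul_inv_cancel_left₀ (hrj j).ne' _
  have e2 : ∀ j, r ^ j * ((r ^ j)⁻¹ * u j) ^ p = (r ^ (1 - p)) ^ j * u j ^ p := fun j => by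
    rw [Real.mul_rpow (inv_nonneg.2 (hrj j).le) (hu j), ← mul_assoc]
    congr 1
    rw [Real.inv_rpow (hrj j).le, ← Real.rpow_natCast, ← Real.rpow_natCast, ← Real.rpow_mul hr0.le,
      ← Real.rpow_mul hr0.le, ← Real.rpow_neg hr0.le, ← Real.rpow_add hr0]
    ring_nf
  simp only [e1, e2] at h
  set S := ∑ j ∈ Finset.range n, (r ^ (1 - p)) ^ j * u j ^ p
  have hS : 0 ≤ S := Finset.sum_nonneg fun j _ => by have := hu j; positivity
  have hg0 : 0 ≤ ∑ j ∈ Finset.range n, r ^ j := Finset.sum_nonneg fun j _ => (hrj j).le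
  have hg : ∑ j ∈ Finset.range n, r ^ j ≤ (1 - r)⁻¹ := by
    rw [← tsum_geometric_of_lt_one hr0.le hr1]
    exact (summable_geometric_of_lt_one hr0.le hr1).sum_le_tsum _ fun j _ => (hrj j).le
  calc (∑ j ∈ Finset.range n, u j) ^ p
      ≤ ((∑ j ∈ Finset.range n, r ^ j) ^ (1 - p⁻¹) * S ^ p⁻¹) ^ p :=
        Real.rpow_le_rpow (Finset.sum_nonneg fun j _ => hu j) h hp0.le
    _ = (∑ j ∈ Finset.range n, r ^ j) ^ (p - 1) * S := by
        rw [Real.mul_rpow (by positivity) (by positivity), ← Real.rpow_mul hg0, ← Real.rpow_mul hS,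
          inv_mul_cancel₀ hp0.ne', Real.rpow_one, sub_mul, inv_mul_cancel₀ hp0.ne', one_mul]
    _ ≤ _ := by
        gcongr

omit [MeasurableSpace X] in
/-- If `|f| ^ p ≤ c W`, the `p`-th power of the tour sum is controlled by a geometrically weighted
sum of `W` along the surviving trajectory. -/
theorem tourSum_rpow_le {f : X → ℝ} {W : X → ℝ≥0∞} {p r c : ℝ} (hp : 1 ≤ p) (hr0 : 0 < r)
    (hr1 : r < 1)
    (hfW : ∀ x, ENNReal.ofReal (|f x| ^ p) ≤ ENNReal.ofReal c * W x) (ω : ℕ → X × Bool) :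
    ENNReal.ofReal (|tourSum f ω| ^ p) ≤ ENNReal.ofReal (((1 - r)⁻¹) ^ (p - 1) * c) *
      ∑' n, ENNReal.ofReal (r ^ (1 - p)) ^ n * (survival n ω * W (ω n).1) := by
  set N := (regenTime ω).toNat with hN
  have hA : 0 ≤ ((1 - r)⁻¹) ^ (p - 1) := by
    have : 0 ≤ 1 - r := by linarith
    positivity
  have h1 : |tourSum f ω| ^ p ≤ ((1 - r)⁻¹) ^ (p - 1) *
      ∑ j ∈ Finset.range N, (r ^ (1 - p)) ^ j * |f (ω j).1| ^ p :=
    (Real.rpow_le_rpow (abs_nonneg _) (Finset.abs_sum_le_sum_abs _ _) (by linarith)).trans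
      (sum_rpow_le_geometric hp hr0 hr1 (u := fun j => |f (ω j).1|) (fun j => abs_nonneg _) N)
  refine (ENNReal.ofReal_le_ofReal h1).trans ?_
  rw [ENNReal.ofReal_mul hA, ENNReal.ofReal_mul hA, mul_assoc]
  refine mul_le_mul_right ?_ _
  rw [ENNReal.ofReal_sum_of_nonneg fun j _ => by positivity, ← ENNReal.tsum_mul_left]
  refine le_trans (Finset.sum_le_sum fun j hj => ?_) (ENNReal.sum_le_tsum (Finset.range N))
  have hs : survival j ω = 1 := by
    refine survival_eq_one_of_lt_regenTime ?_
    have hjN : j < N := Finset.mem_range.1 hj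
    -- If `T = ∞` then `toNat` returns `0` and the tour sum is empty.
    have hne : regenTime ω ≠ ⊤ := fun h => by simp [hN, h] at hjN
    rw [← ENat.natCast_toNat hne]
    exact_mod_cast hjN
  rw [hs, one_mul, ENNReal.ofReal_mul (by positivity), ENNReal.ofReal_pow (by positivity),
    mul_left_comm]
  exact mul_le_mul_right (hfW _) _

-- If `T = ∞`, every term of the series is at least `1`.
omit [MeasurableSpace X] in
theorem regenTime_ne_top_of_tsum_ne_top {W : X → ℝ≥0∞} {r : ℝ≥0∞} (hr : 1 ≤ r)
    (hW : ∀ x, 1 ≤ W x) {ω : ℕ → X × Bool}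
    (h : ∑' n, r ^ n * (survival n ω * W (ω n).1) ≠ ⊤) : regenTime ω ≠ ⊤ := by
  intro hT
  refine h (top_le_iff.1 ?_)
  rw [← ENNReal.tsum_const_eq_top_of_ne_zero (α := ℕ) one_ne_zero]
  refine ENNReal.tsum_le_tsum fun n => ?_
  rw [survival_eq_one_of_lt_regenTime (by rw [hT]; exact ENat.natCast_lt_top n), one_mul]
  exact one_le_mul (one_le_pow₀ hr) (hW _)

/-! ### Contraction from drift and minorisation. -/

/-- After clearing denominators the gap is `β (v - 1) (1 - lam)`; the rate is the value at the worst
case `v = 1`. -/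
theorem add_le_drift_rate_mul {lam β v : ℝ} (hlam : lam < 1) (hβ : 0 ≤ β) (hv : 1 ≤ v) :
    lam * v + β ≤ (lam + β) / (1 + β) * (v + β) := by
  rw [div_mul_eq_mul_div, le_div_iff₀ (by linarith)]
  nlinarith [mul_nonneg hβ (mul_nonneg (sub_nonneg.2 hv) (sub_nonneg.2 hlam.le))]

variable {Γ : Type*} {P : Γ → Kernel X X} {C : Set X} {V : X → ℝ} {lam b : ℝ}

theorem GeometricDrift.lintegral_le_of_notMem [∀ γ, IsMarkovKernel (P γ)]
    (h : GeometricDrift P C V lam b) {β : ℝ} (hβ : 0 ≤ β) (γ : Γ) {x : X} (hx : x ∉ C) :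
    ∫⁻ y, ENNReal.ofReal (V y + β) ∂(P γ x) ≤
      ENNReal.ofReal ((lam + β) / (1 + β)) * ENNReal.ofReal (V x + β) := by
  have hV : ∀ y, 0 ≤ V y := fun y => zero_le_one.trans (h.one_le y)
  have hlam := h.lam_pos
  have hd := h.drift γ x
  rw [Set.indicator_of_notMem hx, add_zero] at hd
  simp_rw [fun y => ENNReal.ofReal_add (hV y) hβ]
  rw [lintegral_add_right _ measurable_const, lintegral_const, measure_univ, mul_one,
    ← ENNReal.ofReal_add (hV x) hβ, ← ENNReal.ofReal_mul (by positivity)]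
  refine (add_le_add_left hd _).trans ?_
  rw [← ENNReal.ofReal_add (mul_nonneg hlam.le (hV x)) hβ]
  exact ENNReal.ofReal_le_ofReal (add_le_drift_rate_mul h.lam_lt_one hβ (h.one_le x))

theorem GeometricDrift.lintegral_sub_le_of_mem [∀ γ, IsMarkovKernel (P γ)]
    (h : GeometricDrift P C V lam b) {δ : ℝ≥0} {ν : Measure X} [IsProbabilityMeasure ν]
    (hmin : ∀ γ, ∀ x ∈ C, δ • ν ≤ P γ x) {β : ℝ} (hβ : 0 ≤ β) (hb : b ≤ δ * β) (γ : Γ) {x : X}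
    (hx : x ∈ C) :
    ∫⁻ y, ENNReal.ofReal (V y + β) ∂(P γ x - δ • ν) ≤
      ENNReal.ofReal ((lam + β) / (1 + β)) * ENNReal.ofReal (V x + β) := by
  have hV : ∀ y, 0 ≤ V y := fun y => zero_le_one.trans (h.one_le y)
  have hlam := h.lam_pos
  have hd := h.drift γ x
  rw [Set.indicator_of_mem hx] at hd
  have hδ : (δ : ℝ) ≤ 1 := delta_le_one (hmin γ) hx
  have hmass : (P γ x - δ • ν) Set.univ = ENNReal.ofReal (1 - δ) := by
    rw [Measure.sub_apply MeasurableSet.univ (hmin γ x hx), Measure.smul_apply, measure_univ,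
      measure_univ, ENNReal.smul_def, smul_eq_mul, mul_one,
      ENNReal.ofReal_sub _ (NNReal.coe_nonneg δ), ENNReal.ofReal_one, ENNReal.ofReal_coe_nnreal]
  simp_rw [fun y => ENNReal.ofReal_add (hV y) hβ]
  rw [lintegral_add_right _ measurable_const, lintegral_const, hmass,
    ← ENNReal.ofReal_add (hV x) hβ, ← ENNReal.ofReal_mul hβ, ← ENNReal.ofReal_mul (by positivity)]
  have hsub : ∫⁻ y, ENNReal.ofReal (V y) ∂(P γ x - δ • ν) ≤
      ENNReal.ofReal (lam * V x + δ * β) :=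
    (lintegral_mono' Measure.sub_le le_rfl).trans
      (hd.trans (ENNReal.ofReal_le_ofReal (by linarith)))
  refine (add_le_add_left hsub _).trans ?_
  rw [← ENNReal.ofReal_add (by have := hV x; positivity)
    (mul_nonneg hβ (sub_nonneg.2 hδ))]
  refine ENNReal.ofReal_le_ofReal (le_trans (le_of_eq ?_)
    (add_le_drift_rate_mul h.lam_lt_one hβ (h.one_le x)))
  ring

/-- A single minorised point suffices: `δ ν(V) ≤ P γ V x`, which the drift makes finite. -/
theorem GeometricDrift.lintegral_ne_top (h : GeometricDrift P C V lam b) {δ : ℝ≥0}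
    (hδ : 0 < δ) {ν : Measure X} [IsProbabilityMeasure ν] {γ : Γ} {x : X}
    (hmin : δ • ν ≤ P γ x) (β : ℝ) :
    ∫⁻ y, ENNReal.ofReal (V y + β) ∂ν ≠ ⊤ := by
  have hV : ∫⁻ y, ENNReal.ofReal (V y) ∂ν ≠ ⊤ := by
    intro htop
    have h1 : ∫⁻ y, ENNReal.ofReal (V y) ∂(δ • ν) ≤ ∫⁻ y, ENNReal.ofReal (V y) ∂(P γ x) :=
      lintegral_mono' hmin le_rfl
    rw [lintegral_smul_measure, htop, ENNReal.smul_def, smul_eq_mul,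
      ENNReal.mul_top (by exact_mod_cast hδ.ne')] at h1
    exact ENNReal.ofReal_ne_top (top_le_iff.1 (h1.trans (h.drift γ x)))
  refine ne_top_of_le_ne_top (ENNReal.add_ne_top.2 ⟨hV, ENNReal.ofReal_ne_top (r := β)⟩) ?_
  calc ∫⁻ y, ENNReal.ofReal (V y + β) ∂ν
      ≤ ∫⁻ y, (ENNReal.ofReal (V y) + ENNReal.ofReal β) ∂ν :=
        lintegral_mono fun y => ENNReal.ofReal_add_le
    _ = _ := by
        rw [lintegral_add_right _ measurable_const, lintegral_const, measure_univ, mul_one]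

omit [MeasurableSpace X] in
theorem abs_le_of_wNorm_lt_top {W g : X → ℝ} (hW : ∀ x, 0 < W x) (h : wNorm W g < ∞) (x : X) :
    |g x| ≤ (wNorm W g).toReal * W x := by
  rw [← div_le_iff₀ (hW x), ← ENNReal.ofReal_le_iff_le_toReal h.ne]
  exact le_iSup (fun x => ENNReal.ofReal (|g x| / W x)) x

end AirMCMC

/-! ### Choice of constants and conclusion. -/

theorem mainTheorem7 {Γ X : Type*} [MeasurableSpace X]
    (P : Γ → ProbabilityTheory.Kernel X X) [∀ γ, ProbabilityTheory.IsMarkovKernel (P γ)]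
    (π : MeasureTheory.Measure X) [MeasureTheory.IsProbabilityMeasure π]
    (C : Set X) (δ : ℝ≥0)
    (ν : MeasureTheory.Measure X) [MeasureTheory.IsProbabilityMeasure ν]
    (hreg : AirMCMC.RegularSmallSet P π C δ ν)
    (V : X → ℝ) (lam b : ℝ) (hdrift : AirMCMC.GeometricDrift P C V lam b)
    (hVC : BddAbove (V '' C))
    (f : X → ℝ) (hf : Measurable f)
    (ε : ℝ) (hε : 0 < ε)
    (hfV : AirMCMC.wNorm (fun x => V x ^ (1 / 2 - ε)) f < ∞) :
    AirMCMC.TourMomentCondition P hreg f := by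
  have hδ : 0 < (δ : ℝ) := hreg.delta_pos
  have hV0 : ∀ x, 0 < V x := fun x => zero_lt_one.trans_le (hdrift.one_le x)
  obtain ⟨β, hβ, hb⟩ : ∃ β : ℝ, 0 ≤ β ∧ b ≤ δ * β :=
    ⟨max b 0 / δ, by positivity, by rw [mul_div_cancel₀ _ hδ.ne']; exact le_max_left _ _⟩
  have hlam := hdrift.lam_pos
  set k := (lam + β) / (1 + β) with hk
  have hk0 : 0 < k := by positivity
  have hk1 : k < 1 := by
    rw [hk, div_lt_one (by positivity)]
    linarith [hdrift.lam_lt_one]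
  set W : X → ℝ≥0∞ := fun x => ENNReal.ofReal (V x + β)
  have hW : Measurable W := (hdrift.measurable.add_const β).ennreal_ofReal
  have hW1 : ∀ x, 1 ≤ W x := fun x => by
    rw [← ENNReal.ofReal_one]
    exact ENNReal.ofReal_le_ofReal (by linarith [hdrift.one_le x])
  -- This choice gives `(1/2 - ε) p = 1 - 4ε² ≤ 1`, so `V ≥ 1` yields `|f| ^ p ≤ A ^ p V`.
  set p := 2 + 4 * ε
  have hp : 1 < p := by linarith
  -- Chosen so that `r ^ (1 - p) = k ^ (-1/2)`.
  set r := k ^ (1 / (2 * (p - 1)))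
  have hr0 : 0 < r := Real.rpow_pos_of_pos hk0 _
  have hr1 : r < 1 := Real.rpow_lt_one hk0.le hk1 (by
    have : 0 < p - 1 := by linarith
    positivity)
  have hρ : r ^ (1 - p) = k ^ (-(1 / 2) : ℝ) := by
    have : p - 1 ≠ 0 := by linarith
    rw [← Real.rpow_mul hk0.le]
    congr 1
    field_simp
    ring
  have hρ1 : 1 ≤ ENNReal.ofReal (r ^ (1 - p)) := by
    rw [← ENNReal.ofReal_one]
    exact ENNReal.ofReal_le_ofReal
      (Real.one_le_rpow_of_pos_of_le_one_of_nonpos hr0 hr1.le (by linarith))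
  have hρk : ENNReal.ofReal (r ^ (1 - p)) * ENNReal.ofReal k < 1 := by
    rw [← ENNReal.ofReal_mul (by positivity), hρ, ← Real.rpow_add_one hk0.ne']
    exact ENNReal.ofReal_lt_one.2 (Real.rpow_lt_one hk0.le hk1 (by norm_num))
  set A := (AirMCMC.wNorm (fun x => V x ^ (1 / 2 - ε)) f).toReal
  have hfW : ∀ x, ENNReal.ofReal (|f x| ^ p) ≤ ENNReal.ofReal (A ^ p) * W x := fun x => by
    rw [← ENNReal.ofReal_mul (by positivity)]
    refine ENNReal.ofReal_le_ofReal ?_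
    have h1 := AirMCMC.abs_le_of_wNorm_lt_top (fun x => Real.rpow_pos_of_pos (hV0 x) _) hfV x
    have h2 : (V x ^ (1 / 2 - ε)) ^ p ≤ V x := by
      rw [← Real.rpow_mul (hV0 x).le]
      refine (Real.rpow_le_rpow_of_exponent_le (hdrift.one_le x) ?_).trans (Real.rpow_one _).le
      simp only [p]
      nlinarith [sq_nonneg ε]
    calc |f x| ^ p ≤ (A * V x ^ (1 / 2 - ε)) ^ p :=
          Real.rpow_le_rpow (abs_nonneg _) h1 (by linarith)
      _ = A ^ p * (V x ^ (1 / 2 - ε)) ^ p :=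
          Real.mul_rpow ENNReal.toReal_nonneg (Real.rpow_nonneg (hV0 x).le _)
      _ ≤ A ^ p * (V x + β) := by gcongr; linarith
  -- Some `γ` is needed to exploit the drift; for empty `Γ` the supremum is trivially zero.
  have hνW : Γ → ∫⁻ x, W x ∂ν ≠ ⊤ := fun γ => by
    obtain ⟨x, hx⟩ := nonempty_of_measure_ne_zero hreg.mass_pos.ne'
    exact hdrift.lintegral_ne_top hreg.delta_pos (hreg.minorisation γ x hx) β
  set B := (1 - ENNReal.ofReal (r ^ (1 - p)) * ENNReal.ofReal k)⁻¹ * ∫⁻ x, W x ∂ν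
  have hB : Γ → B ≠ ⊤ := fun γ =>
    ENNReal.mul_ne_top (ENNReal.inv_ne_top.2 (tsub_pos_of_lt hρk).ne') (hνW γ)
  have hsum : ∀ γ, ∫⁻ ω, ∑' n, ENNReal.ofReal (r ^ (1 - p)) ^ n *
      (AirMCMC.survival n ω * W (ω n).1)
        ∂(AirMCMC.splitLaw (P γ) hreg.measurableSet (hreg.minorisation γ)) ≤ B := fun γ =>
    AirMCMC.lintegral_tsum_survival_le (P γ) hreg.measurableSet (hreg.minorisation γ) hW
      (fun x hx => hdrift.lintegral_le_of_notMem hβ γ hx)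
      (fun x hx => hdrift.lintegral_sub_le_of_mem hreg.minorisation hβ hb γ hx) _
  have hmeas : Measurable fun ω : ℕ → X × Bool =>
      ∑' n, ENNReal.ofReal (r ^ (1 - p)) ^ n * (AirMCMC.survival n ω * W (ω n).1) :=
    Measurable.tsum fun n =>
      ((AirMCMC.measurable_survival n).mul (by fun_prop)).const_mul _
  refine ⟨fun γ => ?_, 4 * ε, by positivity, ?_⟩
  · filter_upwards [ae_lt_top hmeas (ne_top_of_le_ne_top (hB γ) (hsum γ))] with ω hω
    exact AirMCMC.regenTime_ne_top_of_tsum_ne_top hρ1 hW1 hω.ne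
  · rcases isEmpty_or_nonempty Γ with hΓ | ⟨⟨γ₀⟩⟩
    · simp
    · refine lt_of_le_of_lt (iSup_le fun γ => ?_)
        (ENNReal.mul_lt_top (ENNReal.ofReal_lt_top (r := ((1 - r)⁻¹) ^ (p - 1) * A ^ p))
          (hB γ₀).lt_top)
      refine (lintegral_mono (AirMCMC.tourSum_rpow_le hp.le hr0 hr1 hfW)).trans ?_
      rw [lintegral_const_mul _ hmeas]
      exact mul_le_mul_right (hsum γ) _
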